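/- **Conventions.** All C*-algebras are unital and nonzero, and \*-morphisms are unital. For a C*-algebra $A$, let $\mathscr S(A)$ be its state space and $\mathfrak{sa}(A)$ its self-adjoint part. A seminorm defined on a subspace of $\mathfrak{sa}(A)$ is extended by $\infty$ off its domain. *Quantum compact metric spaces.* A $(2,0)$-quasi-Leibniz quantum compact metric space is a pair $(A,\mathsf L)$, where $A$ is a C*-algebra and $\mathsf L$ is a lower semicontinuous seminorm on a dense Jordan–Lie subalgebra of $\mathfrak{sa}(A)$, such that $\{a:\mathsf L(a)=0\}=\mathbb R1_A$; for all $a,b$ in the domain, $\mathsf L\left(\tfrac{ab+ba}{2}\right)$ and $\mathsf L\left(\tfrac{ab-ba}{2i}\right)$ are at most $2(\|a\|\mathsf L(b)+\|b\|\mathsf L(a))$; and the Monge–Kantorovich metric $\mathsf{mk}_{\mathsf L}(\varphi,\psi)=\sup\{|\varphi(a)-\psi(a)|:\mathsf L(a)\le 1\}$ metrizes the weak* topology of $\mathscr S(A)$. *Quantum propinquity.* A bridge $\gamma=(D,\pi_A,\pi_B,\omega)$ from $A$ to $B$ consists of a C*-algebra $D$, injective unital \*-morphisms $\pi_A:A\to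 D$ and $\pi_B:B\to D$, and an element $\omega\in D$ such that $\mathscr S_1(D|\omega)=\{\varphi\in\mathscr S(D):\varphi(1-\omega^*\omega)=\varphi(1-\omega\omega^*)=0\}$ is nonempty. With respect to $\mathsf L_A,\mathsf L_B$, its height is the maximum of the $\mathsf{mk}_{\mathsf L_A}$-Hausdorff distance between $\mathscr S(A)$ and $\{\varphi\circ\pi_A:\varphi\in\mathscr S_1(D|\omega)\}$ and of the $\mathsf{mk}_{\mathsf L_B}$-Hausdorff distance between $\mathscr S(B)$ and $\{\varphi\circ\pi_B:\varphi\in\mathscr S_1(D|\omega)\}$. Its reach is the Hausdorff distance between $\{a\in\mathfrak{sa}(A):\mathsf L_A(a)\le1\}$ and $\{b\in\mathfrak{sa}(B):\mathsf L_B(b)\le1\}$ for the distance $\|\pi_A(a)\omega-\omega\pi_B(b)\|_D$. Its length is the maximum of its height and its reach. The quantum propinquity $\mathsf\Lambda$ between two $(2,0)$-quasi-Leibniz quantum compact metric spaces is the infimum, over finite nonempty chains of bridges joining them through $(2,0)$-quasi-Leibniz quantum compact metric spaces, of the sum of the lengths of the bridges; equivalently, it is the largest pseudo-distance bounded above by the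 length of every bridge. **Theorem.** Let $A$ be the C*-inductive limit of a sequence $\mathcal I=(A_n,\alpha_n)_{n\in\mathbb N}$ of finite-dimensional C*-algebras with injective unital \*-morphisms $\alpha_n:A_n\to A_{n+1}$ and $A_0=\mathbb C$. Let $B_n\subseteq A$ be the canonical image of $A_n$, and let $\mu$ be a faithful tracial state on $A$. For each $n$ there is a unique conditional expectation $E_n:A\to B_n$ onto $B_n$ (a positive linear map of norm $1$ with $E_n(bac)=bE_n(a)c$ for $a\in A$, $b,c\in B_n$) such that $\mu\circ E_n=\mu$. For $x:\mathbb N\to(0,\infty)$ with $x(n)\to0$, set $$\mathsf L^{x}_{\mathcal I,\mu}(a)=\sup_{n\in\mathbb N}\frac{\|a-E_n(a)\|_A}{x(n)}\in[0,\infty]\qquad(a\in\mathfrak{sa}(A)).$$ Let $\beta:\mathbb N\to(0,\infty)$ have limit $0$ at infinity, and let $x$ and $x^k$ ($k\in\mathbb N$) be real sequences with $0<x(n)\le\beta(n)$ and $0<x^k(n)\le\beta(n)$ for all $n,k$, such that $\lim_{k\to\infty}x^k(n)=x(n)$ for every $n$. Then $(A,\mathsf L^{x}_{\mathcal I,\mu})$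 and all $(A,\mathsf L^{x^k}_{\mathcal I,\mu})$ are $(2,0)$-quasi-Leibniz quantum compact metric spaces, and $$\lim_{k\to\infty}\mathsf\Lambda\left((A,\mathsf L^{x^k}_{\mathcal I,\mu}),(A,\mathsf L^{x}_{\mathcal I,\mu})\right)=0.$$ -/

import Mathlib

open Filter Topology
open scoped ENNReal NNReal ComplexOrder

noncomputable section

namespace QuantumMetric

universe u v

/-! ### States -/

section States

variable {A : Type u} [CStarAlgebra A]

/-- The state space of a unital C*-algebra, as a subset of its dual with the weak* topology. -/
def stateSpace (A : Type u) [CStarAlgebra A] : Set (WeakDual ℂ A) :=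
  {φ | φ 1 = 1 ∧ ∀ a : A, 0 ≤ φ (star a * a)}

/-- A functional with the trace property. -/
def IsTracial (μ : WeakDual ℂ A) : Prop := ∀ a b : A, μ (a * b) = μ (b * a)

/-- A faithful positive functional. -/
def IsFaithful (μ : WeakDual ℂ A) : Prop := ∀ a : A, μ (star a * a) = 0 → a = 0

/-- The `1`-level set of an element `ω`. -/
def levelSet (ω : A) : Set (stateSpace A) :=
  {φ | φ.1 (1 - star ω * ω) = 0 ∧ φ.1 (1 - ω * star ω) = 0}

end States

/-! ### Quasi-Leibniz quantum compact metric spaces -/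

section LipNorm

variable {A : Type u} [CStarAlgebra A]

/-- The Jordan product `(ab + ba) / 2` of self-adjoint elements. -/
def jordanMul (a b : selfAdjoint A) : selfAdjoint A :=
  ⟨(1 / 2 : ℂ) • ((a : A) * b + b * a), by
    rw [selfAdjoint.mem_iff, star_smul, star_add, star_mul, star_mul, a.2.star_eq, b.2.star_eq,
      add_comm]
    simp⟩

/-- The Lie product `(ab - ba) / (2i)` of self-adjoint elements. -/
def lieMul (a b : selfAdjoint A) : selfAdjoint A :=
  ⟨(1 / (2 * Complex.I) : ℂ) • ((a : A) * b - b * a), by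
    rw [selfAdjoint.mem_iff, star_smul, star_sub, star_mul, star_mul, a.2.star_eq, b.2.star_eq,
      ← neg_sub, smul_neg, ← neg_smul]
    congr 1
    simp⟩

/-- The Monge-Kantorovich metric of `L`. A seminorm on a subspace of the self-adjoint part is
represented by its extension with value `∞` off its domain. -/
def mkDist (L : selfAdjoint A → ℝ≥0∞) (φ ψ : stateSpace A) : ℝ≥0∞ :=
  ⨆ (a : selfAdjoint A) (_ : L a ≤ 1), ‖φ.1 (a : A) - ψ.1 (a : A)‖ₑ

/-- `(A, L)` is a `(C, D)`-quasi-Leibniz quantum compact metric space. The domain of `L` is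
`{a | L a < ∞}`; it is a real subspace by `map_add_le` and `map_smul`, and closed under the Jordan
and Lie products by `jordan_le` and `lie_le`, hence a Jordan-Lie subalgebra. -/
structure IsQQCMS (C D : ℝ≥0) (L : selfAdjoint A → ℝ≥0∞) : Prop where
  nontrivial : Nontrivial A
  map_add_le : ∀ a b, L (a + b) ≤ L a + L b
  map_smul : ∀ (t : ℝ) (a), L (t • a) = ‖t‖ₑ * L a
  dense_domain : Dense {a | L a < ∞}
  eq_zero_iff : ∀ a, L a = 0 ↔ ∃ t : ℝ, (a : A) = t • (1 : A)
  jordan_le : ∀ a b, L a < ∞ → L b < ∞ →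
    L (jordanMul a b) ≤ C * (‖(a : A)‖ₑ * L b + ‖(b : A)‖ₑ * L a) + D * (L a * L b)
  lie_le : ∀ a b, L a < ∞ → L b < ∞ →
    L (lieMul a b) ≤ C * (‖(a : A)‖ₑ * L b + ‖(b : A)‖ₑ * L a) + D * (L a * L b)
  /-- The Monge-Kantorovich metric metrizes the weak* topology of the state space. -/
  metrizes : ∃ m : MetricSpace (stateSpace A),
    m.toUniformSpace.toTopologicalSpace = instTopologicalSpaceSubtype ∧
      ∀ φ ψ, mkDist L φ ψ = ENNReal.ofReal (m.dist φ ψ)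
  lowerSemicontinuous : LowerSemicontinuous L

end LipNorm

/-- The class of `(C, D)`-quasi-Leibniz quantum compact metric spaces. -/
structure QQCMS (C D : ℝ≥0) : Type (u + 1) where
  alg : Type u
  [cstar : CStarAlgebra alg]
  lip : selfAdjoint alg → ℝ≥0∞
  isQQCMS : IsQQCMS C D lip

attribute [instance] QQCMS.cstar

/-! ### Bridges and the quantum propinquity -/

/-- A bridge between unital C*-algebras. -/
structure Bridge (A B : Type u) [CStarAlgebra A] [CStarAlgebra B] : Type (u + 1) where
  alg : Type u
  [cstar : CStarAlgebra alg]
  left : A →⋆ₐ[ℂ] alg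
  right : B →⋆ₐ[ℂ] alg
  left_injective : Function.Injective left
  right_injective : Function.Injective right
  pivot : alg
  levelSet_nonempty : (levelSet pivot).Nonempty

attribute [instance] Bridge.cstar

/-- The Hausdorff distance of `s` and `t`, for a given distance between points of the one and
points of the other. -/
def hausDist {X Y : Type*} (d : X → Y → ℝ≥0∞) (s : Set X) (t : Set Y) : ℝ≥0∞ :=
  max (⨆ x ∈ s, ⨅ y ∈ t, d x y) (⨆ y ∈ t, ⨅ x ∈ s, d x y)

/-- The image of a set of states under the dual map `φ ↦ φ ∘ π` of a unital *-morphism `π`. -/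
def dualImage {A D : Type u} [CStarAlgebra A] [CStarAlgebra D] (π : A →⋆ₐ[ℂ] D)
    (S : Set (stateSpace D)) : Set (stateSpace A) :=
  {ψ | ∃ φ ∈ S, ∀ a : A, ψ.1 a = φ.1 (π a)}

namespace Bridge

variable {A B : Type u} [CStarAlgebra A] [CStarAlgebra B]

/-- The bridge seminorm. -/
def seminorm (γ : Bridge A B) (a : A) (b : B) : ℝ≥0∞ :=
  ‖γ.left a * γ.pivot - γ.pivot * γ.right b‖ₑ

/-- The height of a bridge. -/
def height (γ : Bridge A B) (LA : selfAdjoint A → ℝ≥0∞) (LB : selfAdjoint B → ℝ≥0∞) : ℝ≥0∞ :=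
  max (hausDist (mkDist LA) Set.univ (dualImage γ.left (levelSet γ.pivot)))
    (hausDist (mkDist LB) Set.univ (dualImage γ.right (levelSet γ.pivot)))

/-- The reach of a bridge: the Hausdorff distance, for the bridge seminorm, between the unit balls
of the two Lip-norms. As these balls are symmetric, it does not matter whether the distance of
`a` and `b` is read as the seminorm of `(a, b)` or of `(a, -b) = (a, 0) - (0, b)`. -/
def reach (γ : Bridge A B) (LA : selfAdjoint A → ℝ≥0∞) (LB : selfAdjoint B → ℝ≥0∞) : ℝ≥0∞ :=
  hausDist (fun (a : selfAdjoint A) (b : selfAdjoint B) => γ.seminorm (a : A) (b : B))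
    {a | LA a ≤ 1} {b | LB b ≤ 1}

/-- The length of a bridge. -/
def length (γ : Bridge A B) (LA : selfAdjoint A → ℝ≥0∞) (LB : selfAdjoint B → ℝ≥0∞) : ℝ≥0∞ :=
  max (γ.height LA LB) (γ.reach LA LB)

/-- The reversed bridge, whose pivot is the adjoint. -/
def symm (γ : Bridge A B) : Bridge B A where
  alg := γ.alg
  left := γ.right
  right := γ.left
  left_injective := γ.right_injective
  right_injective := γ.left_injective
  pivot := star γ.pivot
  levelSet_nonempty := by
    obtain ⟨φ, h1, h2⟩ := γ.levelSet_nonempty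
    exact ⟨φ, by simpa using h2, by simpa using h1⟩

end Bridge

/-- A trek: a finite non-empty chain of bridges through spaces of the class. -/
inductive Trek {C D : ℝ≥0} : QQCMS.{u} C D → QQCMS.{u} C D → Type (u + 1)
  | single {X Y : QQCMS.{u} C D} (γ : Bridge X.alg Y.alg) : Trek X Y
  | cons {X Y Z : QQCMS.{u} C D} (γ : Bridge X.alg Y.alg) (Γ : Trek Y Z) : Trek X Z

/-- The length of a trek: the sum of the lengths of its bridges. -/
def Trek.length {C D : ℝ≥0} : ∀ {X Y : QQCMS.{u} C D}, Trek X Y → ℝ≥0∞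
  | X, Y, .single γ => γ.length X.lip Y.lip
  | X, _, .cons (Y := Y) γ Γ => γ.length X.lip Y.lip + Γ.length

/-- The quantum propinquity on the class of `(C, D)`-quasi-Leibniz quantum compact metric spaces:
the infimum of the lengths of treks. -/
def qPropinquity {C D : ℝ≥0} (X Y : QQCMS.{u} C D) : ℝ≥0∞ := ⨅ Γ : Trek X Y, Γ.length

/-! The quantum propinquity is the largest pseudo-distance which is bounded above by the length of
every bridge. -/

theorem Bridge.symm_length {A B : Type u} [CStarAlgebra A] [CStarAlgebra B] (γ : Bridge A B)
    (LA : selfAdjoint A → ℝ≥0∞) (LB : selfAdjoint B → ℝ≥0∞) :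
    γ.symm.length LB LA = γ.length LA LB := by
  have hl : (levelSet γ.symm.pivot : Set (stateSpace γ.alg)) = levelSet γ.pivot := by
    ext φ
    simp [levelSet, Bridge.symm, and_comm]
  have hs : ∀ (a : selfAdjoint A) (b : selfAdjoint B),
      γ.symm.seminorm (b : B) (a : A) = γ.seminorm (a : A) (b : B) := by
    intro a b
    have h : γ.right (b : B) * star γ.pivot - star γ.pivot * γ.left (a : A)
        = -star (γ.left (a : A) * γ.pivot - γ.pivot * γ.right (b : B)) := by
      rw [star_sub, star_mul, star_mul, ← map_star, ← map_star, a.2.star_eq, b.2.star_eq, neg_sub]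
    change ‖γ.right (b : B) * star γ.pivot - star γ.pivot * γ.left (a : A)‖ₑ = _
    rw [h, enorm_neg, ← ofReal_norm, norm_star, ofReal_norm]
    rfl
  have h1 : γ.symm.height LB LA = γ.height LA LB := by
    unfold Bridge.height
    rw [max_comm]
    change max (hausDist _ _ (dualImage γ.left (levelSet γ.symm.pivot)))
      (hausDist _ _ (dualImage γ.right (levelSet γ.symm.pivot))) = _
    rw [hl]
  have h2 : γ.symm.reach LB LA = γ.reach LA LB := by
    unfold Bridge.reach hausDist
    simp only [hs]
    rw [max_comm]
  rw [Bridge.length, Bridge.length, h1, h2]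

theorem qPropinquity_isGreatest {C D : ℝ≥0} :
    IsGreatest {Ξ : QQCMS.{u} C D → QQCMS.{u} C D → ℝ≥0∞ |
      (∀ X Y, Ξ X Y = Ξ Y X) ∧ (∀ X Y Z, Ξ X Z ≤ Ξ X Y + Ξ Y Z) ∧
        ∀ (X Y) (γ : Bridge X.alg Y.alg), Ξ X Y ≤ γ.length X.lip Y.lip} qPropinquity := by
  have htri : ∀ X Y Z : QQCMS.{u} C D,
      qPropinquity X Z ≤ qPropinquity X Y + qPropinquity Y Z := by
    intro X Y Z
    have key : ∀ {X Y : QQCMS.{u} C D} (Γ : Trek X Y) (Γ' : Trek Y Z),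
        ∃ Γ'' : Trek X Z, Γ''.length = Γ.length + Γ'.length := by
      intro X Y Γ
      induction Γ with
      | single γ => exact fun Γ' => ⟨.cons γ Γ', rfl⟩
      | cons γ Γ ih =>
        intro Γ'
        obtain ⟨Γ'', h⟩ := ih Γ'
        exact ⟨.cons γ Γ'', by rw [Trek.length, Trek.length, h, add_assoc]⟩
    refine ENNReal.le_iInf_add_iInf fun Γ Γ' => ?_
    obtain ⟨Γ'', h⟩ := key Γ Γ'
    exact h ▸ iInf_le _ Γ''
  have hbr : ∀ (X Y : QQCMS.{u} C D) (γ : Bridge X.alg Y.alg),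
      qPropinquity X Y ≤ γ.length X.lip Y.lip := fun X Y γ => iInf_le _ (Trek.single γ)
  have hsymm : ∀ X Y : QQCMS.{u} C D, qPropinquity Y X ≤ qPropinquity X Y := by
    intro X Y
    refine le_iInf fun Γ => ?_
    induction Γ with
    | single γ => exact (hbr _ _ γ.symm).trans (γ.symm_length _ _).le
    | cons γ Γ ih =>
      rw [Trek.length, add_comm]
      exact (htri _ _ _).trans
        (add_le_add ih ((hbr _ _ γ.symm).trans (γ.symm_length _ _).le))
  refine ⟨⟨fun X Y => (hsymm Y X).antisymm (hsymm X Y), htri, hbr⟩, ?_⟩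
  rintro Ξ ⟨-, ht, hb⟩ X Y
  refine le_iInf fun Γ => ?_
  induction Γ with
  | single γ => exact hb _ _ γ
  | cons γ Γ ih => exact (ht _ _ _).trans (add_le_add (hb _ _ γ) ih)

/-! ### Inductive limits, conditional expectations, and the Lip-norms -/

section AF

/-- The composite `𝔄 n → 𝔄 (n + 1) → ⋯ → 𝔄 (n + j)` of the connecting maps. -/
def connect {𝔄 : ℕ → Type v} [∀ n, CStarAlgebra (𝔄 n)] (α : ∀ n, 𝔄 n →⋆ₐ[ℂ] 𝔄 (n + 1)) (n : ℕ) :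
    ∀ j, 𝔄 n →⋆ₐ[ℂ] 𝔄 (n + j)
  | 0 => StarAlgHom.id ℂ (𝔄 n)
  | j + 1 => (α (n + j)).comp (connect α n j)

/-- `A`, with the canonical maps `ι n`, is the C*-inductive limit of `(𝔄 n, α n)`: the completion
of the algebraic direct limit for the C*-seminorm `a ↦ lim ‖a‖` along the sequence. -/
structure IsInductiveLimit {𝔄 : ℕ → Type v} [∀ n, CStarAlgebra (𝔄 n)]
    (α : ∀ n, 𝔄 n →⋆ₐ[ℂ] 𝔄 (n + 1)) {A : Type u} [CStarAlgebra A] (ι : ∀ n, 𝔄 n →⋆ₐ[ℂ] A) :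
    Prop where
  comp_eq : ∀ n a, ι (n + 1) (α n a) = ι n a
  norm_eq : ∀ n a, Tendsto (fun j => ‖connect α n j a‖) atTop (𝓝 ‖ι n a‖)
  dense : Dense (⋃ n, Set.range (ι n))

variable {A : Type u} [CStarAlgebra A]

/-- `E` is a conditional expectation of `A` onto the C*-subalgebra `B`. (An element of a
C*-algebra is positive exactly when it is of the form `b* b`.) -/
structure IsCondExp (B : StarSubalgebra ℂ A) (E : A →L[ℂ] A) : Prop where
  range_eq : Set.range E = B
  positive : ∀ a, ∃ b, E (star a * a) = star b * b
  norm_eq_one : ‖E‖ = 1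
  bimodule : ∀ b ∈ B, ∀ c ∈ B, ∀ a, E (b * a * c) = b * E a * c

/-- `E` is a conditional expectation of `A` onto `B` which preserves `μ`. -/
def IsPreservingCondExp (μ : WeakDual ℂ A) (B : StarSubalgebra ℂ A) (E : A →L[ℂ] A) : Prop :=
  IsCondExp B E ∧ ∀ a, μ (E a) = μ a

open Classical in
/-- The conditional expectation of `A` onto `B` which preserves `μ` (`0` if there is none). -/
def condExp (μ : WeakDual ℂ A) (B : StarSubalgebra ℂ A) : A →L[ℂ] A :=
  if h : ∃ E, IsPreservingCondExp μ B E then h.choose else 0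

/-- The Lip-norm `L(a) = sup_n ‖a - E_n(a)‖ / β(n)`, with `E_n` the conditional expectation onto
the image of `𝔄 n` which preserves `μ`. -/
def lipNorm {𝔄 : ℕ → Type v} [∀ n, CStarAlgebra (𝔄 n)] (ι : ∀ n, 𝔄 n →⋆ₐ[ℂ] A)
    (μ : WeakDual ℂ A) (β : ℕ → ℝ) (a : selfAdjoint A) : ℝ≥0∞ :=
  ⨆ n, ENNReal.ofReal (‖(a : A) - condExp μ (ι n).range (a : A)‖ / β n)

end AF

/-- The real null sequences `x` with `0 < x(n) ≤ β(n)` for all `n`. -/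
def nullBelow (β : ℕ → ℝ) : Set (ℕ → ℝ) :=
  {x | Tendsto x atTop (𝓝 0) ∧ ∀ n, 0 < x n ∧ x n ≤ β n}

end QuantumMetric

end

noncomputable section

namespace QuantumMetric

universe u v

/-! ### States: bounds and weak* compactness -/

section StateBasics

variable {A : Type u} [CStarAlgebra A]

/-! Each `E n` is the orthogonal projection onto `B n` for the inner product of `μ`. The trace
property makes it bimodular, and positivity and contractivity follow. Orthogonality also gives `E m
∘ E n = E m` for `m ≤ n`. From there on only these properties matter, collected in
`IsExpectationTower`.

The unit ball of the Lip-norm is `{a | ∀ n, ‖a - E n a‖ ≤ x n}`. Modulo scalars it is bounded by `x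
0`, and it lies within `x n` of the finite-dimensional `B n`. Hence the Monge-Kantorovich metric is
finite and weak*-continuous, and by compactness it metrizes the weak* topology.

For convergence, take the identity bridge with pivot `1`. Its height is zero, so its length is the
norm Hausdorff distance between the two unit balls. By `exists_norm_sub_le`, an element `a` of one
ball is matched with `E 0 a + r⁻¹ (E N a - E 0 a)`. This lies in `B N`, so only the finitely many
indices `n < N` constrain it, and there pointwise convergence lets `r` be close to `1`. The common
bound `β` makes `N` independent of `k`. -/

theorem state_map_star {φ : WeakDual ℂ A} (hφ : φ ∈ stateSpace A) (a : A) :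
    φ (star a) = star (φ a) := by
  let _ := CStarAlgebra.spectralOrder A
  have := CStarAlgebra.spectralOrderedRing A
  let f : A →ₚ[ℂ] ℂ := PositiveLinearMap.mk₀ ((φ : A →L[ℂ] ℂ) : A →ₗ[ℂ] ℂ) (by
    intro x hx
    obtain ⟨b, rfl⟩ := CStarAlgebra.nonneg_iff_eq_star_mul_self.mp hx
    exact hφ.2 b)
  exact map_star f a

/-- Apply the state to the positive elements `‖a‖ - a` and `‖a‖ + a`. -/
theorem state_norm_le_of_isSelfAdjoint {φ : WeakDual ℂ A} (hφ : φ ∈ stateSpace A) {a : A}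
    (ha : IsSelfAdjoint a) : ‖φ a‖ ≤ ‖a‖ := by
  let _ := CStarAlgebra.spectralOrder A
  have := CStarAlgebra.spectralOrderedRing A
  have hpos : ∀ x : A, 0 ≤ x → 0 ≤ (φ x).re := by
    intro x hx
    obtain ⟨b, rfl⟩ := CStarAlgebra.nonneg_iff_eq_star_mul_self.mp hx
    exact (Complex.le_def.mp (hφ.2 b)).1
  have halg : φ (algebraMap ℝ A ‖a‖) = (‖a‖ : ℂ) := by
    rw [Algebra.algebraMap_eq_smul_one, ← Complex.coe_smul, map_smul, hφ.1]
    simp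
  have h1 := hpos _ (sub_nonneg.mpr ha.le_algebraMap_norm_self)
  have h2 := hpos _ (sub_nonneg.mpr ha.neg.le_algebraMap_norm_self)
  rw [norm_neg] at h2
  rw [map_sub, halg] at h1 h2
  rw [map_neg] at h2
  have him : (φ a).im = 0 := by
    have := state_map_star hφ a
    rw [ha.star_eq] at this
    exact Complex.conj_eq_iff_im.mp this.symm
  have : φ a = ((φ a).re : ℂ) := Complex.ext (by simp) (by simp [him])
  rw [this, Complex.norm_real, Real.norm_eq_abs, abs_le]
  simp at h1 h2
  constructor <;> linarith

/-- Splitting into real and imaginary parts costs a factor 2, which is harmless: only boundedness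
matters below. -/
theorem state_norm_le {φ : WeakDual ℂ A} (hφ : φ ∈ stateSpace A) (a : A) :
    ‖φ a‖ ≤ 2 * ‖a‖ := by
  have h := realPart_add_I_smul_imaginaryPart a
  calc ‖φ a‖ = ‖φ (realPart a : A) + Complex.I * φ (imaginaryPart a : A)‖ := by
        conv_lhs => rw [← h]
        rw [map_add, map_smul, smul_eq_mul]
    _ ≤ ‖φ (realPart a : A)‖ + ‖φ (imaginaryPart a : A)‖ := by
        refine (norm_add_le _ _).trans ?_
        simp
    _ ≤ ‖realPart a‖ + ‖imaginaryPart a‖ :=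
        add_le_add (state_norm_le_of_isSelfAdjoint hφ (realPart a).2)
          (state_norm_le_of_isSelfAdjoint hφ (imaginaryPart a).2)
    _ ≤ ‖a‖ + ‖a‖ := add_le_add (realPart.norm_le a) (imaginaryPart.norm_le a)
    _ = 2 * ‖a‖ := by ring

/-- Banach-Alaoglu: the state space is bounded and cut out by weak*-closed conditions. -/
theorem isCompact_stateSpace (A : Type u) [CStarAlgebra A] : IsCompact (stateSpace A) := by
  refine WeakDual.isCompact_of_bounded_of_closed ?_ ?_
  · refine (Metric.isBounded_closedBall (x := (0 : StrongDual ℂ A)) (r := 2)).subset ?_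
    intro φ hφ
    rw [mem_closedBall_zero_iff]
    exact ContinuousLinearMap.opNorm_le_bound _ zero_le_two fun a => state_norm_le hφ a
  · have h : stateSpace A = {φ : WeakDual ℂ A | φ 1 = 1} ∩
        ⋂ a : A, {φ : WeakDual ℂ A | 0 ≤ φ (star a * a)} := by
      ext φ
      simp [stateSpace]
    rw [h]
    refine (isClosed_eq (WeakDual.eval_continuous 1) continuous_const).inter
      (isClosed_iInter fun a => isClosed_le continuous_const (WeakDual.eval_continuous _))

end StateBasics

/-! ### Trace-preserving conditional expectations -/

section ConditionalExpectation

variable {A : Type u} [CStarAlgebra A] {μ : WeakDual ℂ A} {B : StarSubalgebra ℂ A}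

/-- Test with `b = star (c - d)` and use faithfulness. Identities for the expectations are verified
by this criterion. -/
theorem eq_of_forall_state_mul_eq (hμf : IsFaithful μ) {c d : A} (hc : c ∈ B) (hd : d ∈ B)
    (h : ∀ b ∈ B, μ (b * c) = μ (b * d)) : c = d := by
  rw [← sub_eq_zero]
  refine hμf _ ?_
  rw [mul_sub, map_sub, sub_eq_zero]
  exact h _ (star_mem (sub_mem hc hd))

/-- The projection onto a finite-dimensional subalgebra which is orthogonal for the inner product
of a faithful positive functional. -/
theorem exists_orthogonal_projection [FiniteDimensional ℂ B] (hμf : IsFaithful μ) :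
    ∃ E : A →ₗ[ℂ] A, (∀ a, E a ∈ B) ∧ ∀ a, ∀ b ∈ B, μ (b * E a) = μ (b * a) := by
  let m : A →ₗ[ℂ] ℂ := ((μ : A →L[ℂ] ℂ) : A →ₗ[ℂ] ℂ)
  -- The pairing omits the star so as to be linear in both variables. On `B` it is nondegenerate
  -- because `B` is star-closed; by dimension `T` is then bijective, and the projection is `T⁻¹ ∘
  -- S`.
  let S : A →ₗ[ℂ] Module.Dual ℂ B := LinearMap.mk₂ ℂ (fun a (b : B) => m ((b : A) * a))
    (by intros; simp [mul_add]) (by intros; simp)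
    (by intros; simp [add_mul]) (by intros; simp)
  let T : B →ₗ[ℂ] Module.Dual ℂ B := S.comp B.val.toLinearMap
  have hT : Function.Injective T := by
    intro c d h
    refine Subtype.ext (eq_of_forall_state_mul_eq hμf c.2 d.2 fun b hb => ?_)
    exact LinearMap.congr_fun h ⟨b, hb⟩
  let e := LinearEquiv.ofInjectiveOfFinrankEq T hT Subspace.dual_finrank_eq.symm
  refine ⟨B.val.toLinearMap.comp (e.symm.toLinearMap.comp S), fun a => (e.symm (S a)).2, ?_⟩
  intro a b hb
  exact LinearMap.congr_fun (e.apply_symm_apply (S a)) ⟨b, hb⟩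

end ConditionalExpectation

section ConditionalExpectation

variable {A : Type u} [CStarAlgebra A] {μ : WeakDual ℂ A} {B : StarSubalgebra ℂ A}

/-- An element of a closed subalgebra is positive as soon as it pairs positively, under a faithful
state, with the squares of that subalgebra. -/
theorem exists_eq_star_mul_self_of_state_nonneg (hμ : μ ∈ stateSpace A) (hμf : IsFaithful μ)
    (hB : IsClosed (B : Set A)) {x : A} (hx : x ∈ B) (hsa : IsSelfAdjoint x)
    (h : ∀ b ∈ B, 0 ≤ μ (b * x * star b)) : ∃ b, x = star b * b := by
  let _ := CStarAlgebra.spectralOrder A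
  have := CStarAlgebra.spectralOrderedRing A
  have hneg : x⁻ ∈ B := by
    rw [CFC.negPart_def]
    exact cfcₙ_mem (𝕜' := ℂ) (s := B) (hs := hB) _ hx
  have hnn : 0 ≤ x⁻ := CFC.negPart_nonneg x
  have hns : star x⁻ = x⁻ := (IsSelfAdjoint.of_nonneg hnn).star_eq
  -- Testing with `b = x⁻` gives `-μ((x⁻)³) ≥ 0`, while `(x⁻)³` is positive. Faithfulness kills the
  -- cube, and a nilpotent self-adjoint element vanishes.
  have hprod : x⁻ * x * star x⁻ = -(x⁻ * x⁻ * x⁻) := by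
    conv_lhs => rw [hns]; enter [1, 2]; rw [← CFC.posPart_sub_negPart x hsa]
    rw [mul_sub, CFC.negPart_mul_posPart, zero_sub, neg_mul]
  have hcube : 0 ≤ x⁻ * x⁻ * x⁻ := by
    simpa [hns] using star_left_conjugate_nonneg hnn x⁻
  obtain ⟨c, hc⟩ := CStarAlgebra.nonneg_iff_eq_star_mul_self.mp hcube
  have hzero : x⁻ * x⁻ * x⁻ = 0 := by
    have h1 := h _ hneg
    rw [hprod, map_neg, hc, neg_nonneg] at h1
    rw [hc, hμf c (le_antisymm h1 (hμ.2 c)), mul_zero]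
  have hsq : x⁻ * x⁻ = 0 := by
    rw [← CStarRing.star_mul_self_eq_zero_iff, star_mul, hns]
    rw [← mul_assoc, hzero, zero_mul]
  have : x⁻ = 0 := by
    rw [← CStarRing.star_mul_self_eq_zero_iff, hns, hsq]
  exact CStarAlgebra.nonneg_iff_eq_star_mul_self.mp ((CFC.negPart_eq_zero_iff x hsa).mp this)

/-- A Schwarz inequality for positive maps which are bimodular over their range. -/
theorem norm_le_of_positive_of_bimodule {E : A →ₗ[ℂ] A} (hE : ∀ a, E a ∈ B)
    (hpos : ∀ a, ∃ b, E (star a * a) = star b * b) (hstar : ∀ a, E (star a) = star (E a))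
    (hid : ∀ b ∈ B, E b = b) (hbi : ∀ b ∈ B, ∀ c ∈ B, ∀ a, E (b * a * c) = b * E a * c) (a : A) :
    ‖E a‖ ≤ ‖a‖ := by
  let _ := CStarAlgebra.spectralOrder A
  have := CStarAlgebra.spectralOrderedRing A
  have hnn : ∀ x, 0 ≤ x → 0 ≤ E x := by
    intro x hx
    obtain ⟨c, rfl⟩ := CStarAlgebra.nonneg_iff_eq_star_mul_self.mp hx
    obtain ⟨b, hb⟩ := hpos c
    exact hb ▸ star_mul_self_nonneg b
  have hl : ∀ b ∈ B, ∀ a, E (b * a) = b * E a := fun b hb a => by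
    simpa using hbi b hb 1 B.one_mem a
  have hr : ∀ c ∈ B, ∀ a, E (a * c) = E a * c := fun c hc a => by
    simpa using hbi 1 B.one_mem c hc a
  -- Expand `0 ≤ E (star (a - E a) * (a - E a))`.
  have h1 : star (E a) * E a ≤ E (star a * a) := by
    have h := hnn _ (star_mul_self_nonneg (a - E a))
    have e : E (star (a - E a) * (a - E a)) = E (star a * a) - star (E a) * E a := by
      rw [star_sub, sub_mul, mul_sub, mul_sub, map_sub, map_sub, map_sub, hr _ (hE a),
        hl _ (star_mem (hE a)), hl _ (star_mem (hE a)), hid _ (hE a), hstar]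
      abel
    rw [e] at h
    exact sub_nonneg.mp h
  have h2 : E (star a * a) ≤ algebraMap ℝ A ‖star a * a‖ := by
    have h := hnn _ (sub_nonneg.mpr (IsSelfAdjoint.star_mul_self a).le_algebraMap_norm_self)
    rw [map_sub] at h
    have e : E (algebraMap ℝ A ‖star a * a‖) = algebraMap ℝ A ‖star a * a‖ := by
      rw [Algebra.algebraMap_eq_smul_one, ← Complex.coe_smul, map_smul, hid _ B.one_mem]
    rw [e] at h
    exact sub_nonneg.mp h
  have h3 := (CStarAlgebra.norm_le_iff_le_algebraMap (star (E a) * E a) (norm_nonneg (star a * a))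
    (star_mul_self_nonneg _)).mpr (h1.trans h2)
  rw [CStarRing.norm_star_mul_self, CStarRing.norm_star_mul_self] at h3
  exact (abs_le_of_sq_le_sq' (by nlinarith) (norm_nonneg _)).2

theorem IsPreservingCondExp.state_mul_apply {E : A →L[ℂ] A} (hE : IsPreservingCondExp μ B E)
    {b : A} (hb : b ∈ B) (a : A) : μ (b * E a) = μ (b * a) := by
  have h := hE.1.bimodule b hb 1 B.one_mem a
  rw [mul_one, mul_one] at h
  rw [← h, hE.2]

theorem IsCondExp.apply_mem {E : A →L[ℂ] A} (hE : IsCondExp B E) (a : A) : E a ∈ B := by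
  have h : E a ∈ Set.range E := ⟨a, rfl⟩
  rwa [hE.range_eq] at h

/-- Uniqueness: bimodularity and invariance of `μ` force orthogonality, which determines `E`.
Existence: take the orthogonal projection; traciality moves a right factor from `B` to the front,
which yields bimodularity. -/
theorem existsUnique_isPreservingCondExp [FiniteDimensional ℂ B] (hμ : μ ∈ stateSpace A)
    (hμt : IsTracial μ) (hμf : IsFaithful μ) : ∃! E, IsPreservingCondExp μ B E := by
  refine existsUnique_of_exists_of_unique ?_ ?_
  · obtain ⟨E, hE, hp⟩ := exists_orthogonal_projection (B := B) hμf
    have hB : IsClosed (B : Set A) :=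
      Submodule.closed_of_finiteDimensional (Subalgebra.toSubmodule B.toSubalgebra)
    have hp' : ∀ a, ∀ b ∈ B, μ (E a * b) = μ (a * b) := fun a b hb => by
      rw [hμt, hp a b hb, hμt]
    have hid : ∀ b ∈ B, E b = b := fun b hb =>
      eq_of_forall_state_mul_eq hμf (hE b) hb fun c hc => hp b c hc
    have hbi : ∀ b ∈ B, ∀ c ∈ B, ∀ a, E (b * a * c) = b * E a * c := by
      intro b hb c hc a
      refine eq_of_forall_state_mul_eq hμf (hE _) (mul_mem (mul_mem hb (hE a)) hc) fun d hd => ?_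
      rw [hp _ d hd, ← mul_assoc, hμt _ c, ← mul_assoc d (b * E a), hμt _ c]
      simp only [← mul_assoc]
      rw [hp a _ (mul_mem (mul_mem hc hd) hb)]
    have hstar : ∀ a, E (star a) = star (E a) := by
      intro a
      refine eq_of_forall_state_mul_eq hμf (hE _) (star_mem (hE a)) fun b hb => ?_
      rw [hp _ b hb, ← star_star b, ← star_mul, ← star_mul, state_map_star hμ, state_map_star hμ,
        hp' a _ (star_mem hb)]
    have hpos : ∀ a, ∃ b, E (star a * a) = star b * b := by
      intro a
      refine exists_eq_star_mul_self_of_state_nonneg hμ hμf hB (hE _) ?_ fun b hb => ?_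
      · rw [IsSelfAdjoint, ← hstar, star_mul, star_star]
      -- By bimodularity `b * E (star a * a) * star b` is the image of a square, namely that of `a *
      -- star b`, and `E` preserves `μ`.
      · rw [← hbi b hb _ (star_mem hb)]
        have h := hp (b * (star a * a) * star b) 1 B.one_mem
        rw [one_mul, one_mul] at h
        rw [h]
        simpa [mul_assoc] using hμ.2 (a * star b)
    have hnorm := norm_le_of_positive_of_bimodule hE hpos hstar hid hbi
    let F : A →L[ℂ] A := E.mkContinuous 1 (by simpa using hnorm)
    have hnt : Nontrivial A := ⟨1, 0, fun h => by simpa [h] using hμ.1⟩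
    refine ⟨F, ⟨?_, hpos, ?_, hbi⟩, fun a => ?_⟩
    · ext b
      exact ⟨fun ⟨a, ha⟩ => ha ▸ hE a, fun hb => ⟨b, hid b hb⟩⟩
    · refine le_antisymm (E.mkContinuous_norm_le zero_le_one _) ?_
      have h := F.le_opNorm 1
      rwa [show F 1 = 1 from hid 1 B.one_mem, norm_one, mul_one] at h
    · have h := hp a 1 B.one_mem
      rwa [one_mul, one_mul] at h
  · intro E F hE hF
    ext a
    refine eq_of_forall_state_mul_eq hμf (hE.1.apply_mem a) (hF.1.apply_mem a) fun b hb => ?_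
    rw [hE.state_mul_apply hb, hF.state_mul_apply hb]

theorem isPreservingCondExp_condExp [FiniteDimensional ℂ B] (hμ : μ ∈ stateSpace A)
    (hμt : IsTracial μ) (hμf : IsFaithful μ) : IsPreservingCondExp μ B (condExp μ B) := by
  have h := (existsUnique_isPreservingCondExp (B := B) hμ hμt hμf).exists
  rw [condExp, dif_pos h]
  exact h.choose_spec

end ConditionalExpectation

/-! ### Towers of expectations and the quasi-Leibniz seminorm -/

section ExpectationTower

variable {A : Type u} [CStarAlgebra A]

/-- Compatible conditional expectations onto an increasing sequence of finite-dimensional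
subalgebras with dense union, the first of which is trivial. -/
structure IsExpectationTower (B : ℕ → StarSubalgebra ℂ A) (E : ℕ → A →L[ℂ] A) : Prop where
  finiteDimensional : ∀ n, FiniteDimensional ℂ (B n)
  mono : Monotone B
  dense : Dense (⋃ n, (B n : Set A))
  exists_eq_smul_one : ∀ b ∈ B 0, ∃ z : ℂ, b = z • (1 : A)
  apply_mem : ∀ n a, E n a ∈ B n
  apply_of_mem : ∀ n, ∀ b ∈ B n, E n b = b
  apply_apply : ∀ m n, m ≤ n → ∀ a, E m (E n a) = E m a
  norm_apply_le : ∀ n a, ‖E n a‖ ≤ ‖a‖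
  map_star : ∀ n a, E n (star a) = star (E n a)
  map_mul_right : ∀ n, ∀ b ∈ B n, ∀ a, E n (a * b) = E n a * b

/-- The seminorm `sup_n ‖a - E_n(a)‖ / x(n)`. -/
def towerLip (E : ℕ → A →L[ℂ] A) (x : ℕ → ℝ) (a : selfAdjoint A) : ℝ≥0∞ :=
  ⨆ n, ENNReal.ofReal (‖(a : A) - E n a‖ / x n)

theorem towerLip_le_one_iff {E : ℕ → A →L[ℂ] A} {x : ℕ → ℝ} (hx : ∀ n, 0 < x n)
    {a : selfAdjoint A} : towerLip E x a ≤ 1 ↔ ∀ n, ‖(a : A) - E n a‖ ≤ x n := by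
  rw [towerLip, iSup_le_iff]
  refine forall_congr' fun n => ?_
  rw [ENNReal.ofReal_le_one, div_le_one (hx n)]

theorem towerLip_add_le {E : ℕ → A →L[ℂ] A} {x : ℕ → ℝ} (hx : ∀ n, 0 < x n)
    (a b : selfAdjoint A) : towerLip E x (a + b) ≤ towerLip E x a + towerLip E x b := by
  refine iSup_le fun n => le_trans ?_ (add_le_add (le_iSup _ n) (le_iSup _ n))
  rw [← ENNReal.ofReal_add (div_nonneg (norm_nonneg _) (hx n).le)
    (div_nonneg (norm_nonneg _) (hx n).le), ← add_div]
  refine ENNReal.ofReal_le_ofReal (div_le_div_of_nonneg_right ?_ (hx n).le)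
  rw [AddSubgroup.coe_add, map_add, add_sub_add_comm]
  exact norm_add_le _ _

theorem towerLip_smul (E : ℕ → A →L[ℂ] A) (x : ℕ → ℝ) (t : ℝ) (a : selfAdjoint A) :
    towerLip E x (t • a) = ‖t‖ₑ * towerLip E x a := by
  rw [towerLip, towerLip, ENNReal.mul_iSup]
  refine iSup_congr fun n => ?_
  rw [← ofReal_norm, ← ENNReal.ofReal_mul (norm_nonneg _), selfAdjoint.val_smul,
    ← Complex.coe_smul, map_smul, ← smul_sub, norm_smul, Complex.norm_real, mul_div_assoc]

theorem lowerSemicontinuous_towerLip (E : ℕ → A →L[ℂ] A) (x : ℕ → ℝ) :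
    LowerSemicontinuous (towerLip E x) := by
  refine lowerSemicontinuous_iSup fun n => Continuous.lowerSemicontinuous ?_
  refine ENNReal.continuous_ofReal.comp (Continuous.div_const (Continuous.norm ?_) _)
  exact continuous_subtype_val.sub ((E n).continuous.comp continuous_subtype_val)

theorem towerLip_le_of_forall {x : ℕ → ℝ} (hx : ∀ n, 0 < x n) {a b c : selfAdjoint A}
    (hc : ∀ n, ‖(c : A) - E n c‖ ≤
      2 * (‖(a : A)‖ * ‖(b : A) - E n b‖ + ‖(b : A)‖ * ‖(a : A) - E n a‖)) :
    towerLip E x c ≤ 2 * (‖(a : A)‖ₑ * towerLip E x b + ‖(b : A)‖ₑ * towerLip E x a) := by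
  refine iSup_le fun n => le_trans ?_ (mul_le_mul_right (add_le_add
    (mul_le_mul_right (le_iSup _ n) _) (mul_le_mul_right (le_iSup _ n) _)) _)
  have hn := hx n
  rw [← ofReal_norm, ← ofReal_norm, ← ENNReal.ofReal_mul (norm_nonneg _),
    ← ENNReal.ofReal_mul (norm_nonneg _), ← ENNReal.ofReal_add (by positivity) (by positivity),
    ← ENNReal.ofReal_ofNat 2, ← ENNReal.ofReal_mul zero_le_two]
  refine ENNReal.ofReal_le_ofReal ?_
  calc _ ≤ _ := div_le_div_of_nonneg_right (hc n) hn.le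
    _ = _ := by ring

namespace IsExpectationTower

variable {B : ℕ → StarSubalgebra ℂ A} {E : ℕ → A →L[ℂ] A} (h : IsExpectationTower B E)
include h

/-- The terms of index at least `n` vanish, so the supremum is dominated by a finite sum. -/
theorem towerLip_lt_top {n : ℕ} {a : selfAdjoint A} (ha : (a : A) ∈ B n) (x : ℕ → ℝ) :
    towerLip E x a < ∞ := by
  refine lt_of_le_of_lt (b := ∑ m ∈ Finset.range n,
    ENNReal.ofReal (‖(a : A) - E m a‖ / x m)) (iSup_le fun m => ?_)
    (ENNReal.sum_lt_top.mpr fun _ _ => ENNReal.ofReal_lt_top)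
  by_cases hm : m < n
  · exact Finset.single_le_sum (f := fun m => ENNReal.ofReal (‖(a : A) - E m a‖ / x m))
      (fun _ _ => zero_le) (Finset.mem_range.mpr hm)
  · rw [h.apply_of_mem m a (h.mono (not_lt.mp hm) ha)]
    simp

theorem dense_towerLip_lt_top (x : ℕ → ℝ) : Dense {a | towerLip E x a < ∞} := by
  have hc : Continuous (realPart : A →ₗ[ℝ] selfAdjoint A) :=
    AddMonoidHomClass.continuous_of_bound _ 1 fun a => by simpa using realPart.norm_le a
  have hs : Function.Surjective (realPart : A →ₗ[ℝ] selfAdjoint A) := fun a =>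
    ⟨a, Subtype.ext a.2.coe_realPart⟩
  refine (hs.denseRange.dense_image hc h.dense).mono ?_
  rintro _ ⟨b, hb, rfl⟩
  obtain ⟨n, hn⟩ := Set.mem_iUnion.mp hb
  refine h.towerLip_lt_top (n := n) ?_ x
  rw [realPart_apply_coe, ← Complex.coe_smul]
  exact (B n).smul_mem (add_mem hn (star_mem hn)) _

theorem towerLip_eq_zero_iff {x : ℕ → ℝ} (hx : ∀ n, 0 < x n) (a : selfAdjoint A) :
    towerLip E x a = 0 ↔ ∃ t : ℝ, (a : A) = t • (1 : A) := by
  constructor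
  · intro h0
    have h1 := (ENNReal.iSup_eq_zero.mp h0) 0
    rw [ENNReal.ofReal_eq_zero, div_le_iff₀ (hx 0), zero_mul, norm_le_zero_iff, sub_eq_zero] at h1
    obtain ⟨z, hz⟩ := h.exists_eq_smul_one _ (h.apply_mem 0 a)
    refine ⟨z.re, ?_⟩
    have h2 := congrArg (fun b : selfAdjoint A => (b : A))
      (Subtype.ext a.2.coe_realPart : realPart (a : A) = a)
    rw [← h2, h1, hz, realPart_smul]
    simp
  · rintro ⟨t, ht⟩
    refine ENNReal.iSup_eq_zero.mpr fun n => ?_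
    rw [h.apply_of_mem n a, sub_self, norm_zero, zero_div, ENNReal.ofReal_zero]
    rw [ht, ← Complex.coe_smul]
    exact (B n).smul_mem (B n).one_mem _

theorem norm_mul_sub_le (n : ℕ) (a b : A) :
    ‖a * b - E n (a * b)‖ ≤ ‖a - E n a‖ * ‖b‖ + 2 * (‖a‖ * ‖b - E n b‖) := by
  have h1 : a * b - E n (a * b) = a * (b - E n b) + (a - E n a) * E n b
      - E n (a * (b - E n b)) := by
    rw [mul_sub, map_sub, h.map_mul_right n _ (h.apply_mem n b), sub_mul]
    abel
  have h2 := h.norm_apply_le n (a * (b - E n b))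
  have h3 := norm_mul_le a (b - E n b)
  have h4 := (norm_mul_le (a - E n a) (E n b)).trans
    (mul_le_mul_of_nonneg_left (h.norm_apply_le n b) (norm_nonneg _))
  rw [h1]
  linarith [norm_sub_le (a * (b - E n b) + (a - E n a) * E n b) (E n (a * (b - E n b))),
    norm_add_le (a * (b - E n b)) ((a - E n a) * E n b)]

/-- Treats the Jordan (`s = 1`) and Lie (`s = -1`) products together. Averaging the bounds for `ab`
and `ba` gives the constant 3/2, within the required 2. -/
theorem norm_jordan_sub_le (n : ℕ) (a b : A) (c : ℂ) (hc : ‖c‖ = 1 / 2) (s : ℂ) (hs : ‖s‖ = 1) :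
    ‖c • (a * b + s • (b * a)) - E n (c • (a * b + s • (b * a)))‖ ≤
      2 * (‖a‖ * ‖b - E n b‖ + ‖b‖ * ‖a - E n a‖) := by
  have e : c • (a * b + s • (b * a)) - E n (c • (a * b + s • (b * a))) =
      c • ((a * b - E n (a * b)) + s • (b * a - E n (b * a))) := by
    simp only [map_smul, map_add, smul_sub, smul_add]
    abel
  rw [e, norm_smul, hc]
  have h1 := h.norm_mul_sub_le n a b
  have h2 := h.norm_mul_sub_le n b a
  have h3 := norm_add_le (a * b - E n (a * b)) (s • (b * a - E n (b * a)))
  rw [norm_smul, hs, one_mul] at h3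
  have h4 : 0 ≤ ‖a‖ * ‖b - E n b‖ := by positivity
  have h5 : 0 ≤ ‖b‖ * ‖a - E n a‖ := by positivity
  nlinarith

end IsExpectationTower

end ExpectationTower

/-! ### The Monge-Kantorovich metric and the weak* topology -/

section Metrization

variable {A : Type u} [CStarAlgebra A]

theorem mkDist_self (L : selfAdjoint A → ℝ≥0∞) (φ : stateSpace A) : mkDist L φ φ = 0 := by
  simp [mkDist]

theorem mkDist_comm (L : selfAdjoint A → ℝ≥0∞) (φ ψ : stateSpace A) :
    mkDist L φ ψ = mkDist L ψ φ := by
  unfold mkDist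
  simp only [enorm_sub_rev]

theorem mkDist_triangle (L : selfAdjoint A → ℝ≥0∞) (φ χ ψ : stateSpace A) :
    mkDist L φ ψ ≤ mkDist L φ χ + mkDist L χ ψ := by
  refine iSup₂_le fun a ha => ?_
  refine le_trans ?_ (add_le_add (le_iSup₂ (f := fun (a : selfAdjoint A) (_ : L a ≤ 1) =>
    ‖φ.1 (a : A) - χ.1 (a : A)‖ₑ) a ha) (le_iSup₂ (f := fun (a : selfAdjoint A) (_ : L a ≤ 1) =>
    ‖χ.1 (a : A) - ψ.1 (a : A)‖ₑ) a ha))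
  rw [← sub_add_sub_cancel (φ.1 (a : A)) (χ.1 (a : A)) (ψ.1 (a : A))]
  exact enorm_add_le _ _

theorem eq_of_mkDist_eq_zero {L : selfAdjoint A → ℝ≥0∞}
    (hL : ∀ (t : ℝ) (a), L (t • a) = ‖t‖ₑ * L a) (hd : Dense {a | L a < ∞}) {φ ψ : stateSpace A}
    (h : mkDist L φ ψ = 0) : φ = ψ := by
  have h1 : ∀ a : selfAdjoint A, L a ≤ 1 → φ.1 (a : A) = ψ.1 (a : A) := by
    intro a ha
    have h2 := (ENNReal.iSup_eq_zero.mp (ENNReal.iSup_eq_zero.mp h a)) ha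
    rwa [enorm_eq_zero, sub_eq_zero] at h2
  have h2 : ∀ a : selfAdjoint A, L a < ∞ → φ.1 (a : A) = ψ.1 (a : A) := by
    intro a ha
    -- The added 1 keeps the rescaling factor invertible when `L a = 0`.
    have ht : 0 < (L a).toReal + 1 := by positivity
    have h3 := h1 (((L a).toReal + 1)⁻¹ • a) (by
      rw [hL, ← ofReal_norm, Real.norm_of_nonneg (inv_nonneg.mpr ht.le),
        ← ENNReal.ofReal_toReal_eq_iff.mpr ha.ne, ENNReal.toReal_ofReal ENNReal.toReal_nonneg,
        ← ENNReal.ofReal_mul (inv_nonneg.mpr ht.le), ENNReal.ofReal_le_one, inv_mul_le_one₀ ht]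
      linarith)
    rw [selfAdjoint.val_smul, ← Complex.coe_smul, map_smul, map_smul] at h3
    exact smul_right_injective ℂ (by exact_mod_cast (inv_pos.mpr ht).ne') h3
  have h3 : (fun a : selfAdjoint A => φ.1 (a : A)) = fun a : selfAdjoint A => ψ.1 (a : A) :=
    Continuous.ext_on hd ((map_continuous φ.1).comp continuous_subtype_val)
      ((map_continuous ψ.1).comp continuous_subtype_val) fun a ha => h2 a ha
  refine Subtype.ext (DFunLike.ext _ _ fun a => ?_)
  rw [← realPart_add_I_smul_imaginaryPart a, map_add, map_add, map_smul, map_smul]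
  have h4 : φ.1 (realPart a : A) = ψ.1 (realPart a : A) := congrFun h3 (realPart a)
  have h5 : φ.1 (imaginaryPart a : A) = ψ.1 (imaginaryPart a : A) := congrFun h3 (imaginaryPart a)
  rw [h4, h5]

/-- Since the state space is weak*-compact, the Monge-Kantorovich metric metrizes the weak*
topology as soon as it is weak*-continuous. -/
theorem exists_metricSpace_of_eventually_mkDist_lt {L : selfAdjoint A → ℝ≥0∞}
    (hL : ∀ (t : ℝ) (a), L (t • a) = ‖t‖ₑ * L a) (hd : Dense {a | L a < ∞})
    (hfin : ∀ φ ψ : stateSpace A, mkDist L φ ψ ≠ ∞)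
    (hcont : ∀ φ : stateSpace A, ∀ ε : ℝ, 0 < ε →
      ∀ᶠ ψ in 𝓝 φ, mkDist L ψ φ < ENNReal.ofReal ε) :
    ∃ m : MetricSpace (stateSpace A),
      m.toUniformSpace.toTopologicalSpace = instTopologicalSpaceSubtype ∧
        ∀ φ ψ, mkDist L φ ψ = ENNReal.ofReal (m.dist φ ψ) := by
  let m : MetricSpace (stateSpace A) :=
    { dist := fun φ ψ => (mkDist L φ ψ).toReal
      dist_self := fun φ => by simp [mkDist_self]
      dist_comm := fun φ ψ => by rw [mkDist_comm]
      dist_triangle := fun φ χ ψ => by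
        rw [← ENNReal.toReal_add (hfin _ _) (hfin _ _)]
        exact ENNReal.toReal_mono (ENNReal.add_ne_top.mpr ⟨hfin _ _, hfin _ _⟩)
          (mkDist_triangle L φ χ ψ)
      eq_of_dist_eq_zero := fun {φ ψ} h0 => eq_of_mkDist_eq_zero hL hd
        (((ENNReal.toReal_eq_zero_iff _).mp h0).resolve_right (hfin _ _)) }
  refine ⟨m, ?_, fun φ ψ => (ENNReal.ofReal_toReal (hfin φ ψ)).symm⟩
  have hcompact : CompactSpace (stateSpace A) := isCompact_iff_compactSpace.mp (isCompact_stateSpace A)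
  have hid : @Continuous _ _ instTopologicalSpaceSubtype m.toUniformSpace.toTopologicalSpace
      (Equiv.refl (stateSpace A)) := by
    refine (@Metric.continuous_iff' _ _ m.toPseudoMetricSpace instTopologicalSpaceSubtype _).mpr ?_
    intro φ ε hε
    filter_upwards [hcont φ ε hε] with ψ hψ
    exact (ENNReal.toReal_lt_of_lt_ofReal hψ)
  have hT2 : @T2Space (stateSpace A) m.toUniformSpace.toTopologicalSpace := inferInstance
  refine le_antisymm ?_ (continuous_id_iff_le.mp hid)
  have e := @Continuous.continuous_symm_of_equiv_compact_to_t2 _ _ instTopologicalSpaceSubtype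
    m.toUniformSpace.toTopologicalSpace hcompact hT2 (Equiv.refl _) hid
  exact continuous_id_iff_le.mp e

namespace IsExpectationTower

variable {B : ℕ → StarSubalgebra ℂ A} {E : ℕ → A →L[ℂ] A} (h : IsExpectationTower B E)
include h

/-- `E 0 a` is a scalar, on which all states agree. -/
theorem state_sub_eq (φ ψ : stateSpace A) (a : A) :
    φ.1 a - ψ.1 a = φ.1 (a - E 0 a) - ψ.1 (a - E 0 a) := by
  obtain ⟨z, hz⟩ := h.exists_eq_smul_one _ (h.apply_mem 0 a)
  rw [map_sub, map_sub, hz, map_smul, map_smul, φ.2.1, ψ.2.1]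
  ring

theorem norm_state_sub_le (φ ψ : stateSpace A) (n : ℕ) (a : A) :
    ‖φ.1 a - ψ.1 a‖ ≤ 4 * ‖a - E n a‖ + ‖φ.1 (E n a - E 0 a) - ψ.1 (E n a - E 0 a)‖ := by
  have e : φ.1 a - ψ.1 a = (φ.1 (a - E n a) - ψ.1 (a - E n a))
      + (φ.1 (E n a - E 0 a) - ψ.1 (E n a - E 0 a)) := by
    rw [h.state_sub_eq, ← sub_add_sub_cancel a (E n a) (E 0 a), map_add, map_add]
    ring
  have h1 := norm_add_le (φ.1 (a - E n a) - ψ.1 (a - E n a))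
    (φ.1 (E n a - E 0 a) - ψ.1 (E n a - E 0 a))
  rw [← e] at h1
  linarith [norm_sub_le (φ.1 (a - E n a)) (ψ.1 (a - E n a)), state_norm_le φ.2 (a - E n a),
    state_norm_le ψ.2 (a - E n a)]

theorem norm_apply_sub_apply_zero_le (n : ℕ) (a : A) : ‖E n a - E 0 a‖ ≤ ‖a - E 0 a‖ := by
  have e : E n a - E 0 a = E n (a - E 0 a) := by
    rw [map_sub, h.apply_of_mem n _ (h.mono n.zero_le (h.apply_mem 0 a))]
  rw [e]
  exact h.norm_apply_le _ _

theorem mkDist_towerLip_ne_top {x : ℕ → ℝ} (hx : ∀ n, 0 < x n) (φ ψ : stateSpace A) :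
    mkDist (towerLip E x) φ ψ ≠ ∞ := by
  refine ne_top_of_le_ne_top (ENNReal.ofReal_ne_top (r := 4 * x 0)) (iSup₂_le fun a ha => ?_)
  rw [← ofReal_norm]
  refine ENNReal.ofReal_le_ofReal ((h.norm_state_sub_le φ ψ 0 a).trans ?_)
  have h1 := (towerLip_le_one_iff hx).mp ha 0
  simp only [sub_self, map_zero, norm_zero, add_zero]
  linarith

/-- On the unit ball of a finite-dimensional subspace, weak* convergence is uniform. -/
theorem eventually_norm_state_sub_le (n : ℕ) (φ : stateSpace A) {R ε : ℝ} (hε : 0 < ε) :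
    ∀ᶠ ψ in 𝓝 φ, ∀ b ∈ B n, ‖b‖ ≤ R → ‖ψ.1 b - φ.1 b‖ ≤ ε := by
  have := h.finiteDimensional n
  let e := Module.finBasis ℂ (B n)
  let c := fun i => LinearMap.toContinuousLinearMap (e.coord i)
  have hev : ∀ a : A, Continuous fun ψ : stateSpace A => ψ.1 a := fun a =>
    (WeakDual.eval_continuous a).comp continuous_subtype_val
  -- This finite sum over a basis dominates the error uniformly on the ball, is weak*-continuous in
  -- `ψ`, and vanishes at `φ`.
  have hg : Continuous fun ψ : stateSpace A =>
      ∑ i, ‖c i‖ * R * ‖ψ.1 (e i : A) - φ.1 (e i : A)‖ :=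
    continuous_finsetSum _ fun i _ =>
      continuous_const.mul ((hev _).sub continuous_const).norm
  have h0 := hg.tendsto φ
  simp only [sub_self, norm_zero, mul_zero, Finset.sum_const_zero] at h0
  filter_upwards [h0.eventually_lt_const hε] with ψ hψ b hb hbR
  refine le_trans ?_ hψ.le
  have hsum : b = ∑ i, c i ⟨b, hb⟩ • (e i : A) := by
    have h1 := congrArg (Subtype.val) (e.sum_repr ⟨b, hb⟩)
    rw [AddSubmonoidClass.coe_finsetSum] at h1
    exact h1.symm
  have h2 : ψ.1 b - φ.1 b = ∑ i, c i ⟨b, hb⟩ * (ψ.1 (e i : A) - φ.1 (e i : A)) := by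
    conv_lhs => rw [hsum]
    simp [map_sum, mul_sub, Finset.sum_sub_distrib]
  rw [h2]
  refine (norm_sum_le _ _).trans (Finset.sum_le_sum fun i _ => ?_)
  rw [norm_mul]
  refine mul_le_mul_of_nonneg_right (((c i).le_opNorm _).trans ?_) (norm_nonneg _)
  exact mul_le_mul_of_nonneg_left hbR (norm_nonneg _)

theorem eventually_mkDist_towerLip_lt {x : ℕ → ℝ} (hx : ∀ n, 0 < x n)
    (hx0 : Tendsto x atTop (𝓝 0)) (φ : stateSpace A) {ε : ℝ} (hε : 0 < ε) :
    ∀ᶠ ψ in 𝓝 φ, mkDist (towerLip E x) ψ φ < ENNReal.ofReal ε := by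
  -- The budget is `4 * (ε / 16) + ε / 4 = ε / 2`, which leaves room for strict inequality after the
  -- supremum.
  obtain ⟨n, hn⟩ := (hx0.eventually_lt_const (show 0 < ε / 16 by positivity)).exists
  filter_upwards [h.eventually_norm_state_sub_le n φ (R := x 0)
    (show 0 < ε / 4 by positivity)] with ψ hψ
  refine lt_of_le_of_lt (b := ENNReal.ofReal (ε / 2)) (iSup₂_le fun a ha => ?_)
    ((ENNReal.ofReal_lt_ofReal_iff hε).mpr (by linarith))
  rw [towerLip_le_one_iff hx] at ha
  rw [← ofReal_norm]
  refine ENNReal.ofReal_le_ofReal ((h.norm_state_sub_le ψ φ n a).trans ?_)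
  have h1 := hψ (E n a - E 0 a)
    (sub_mem (h.apply_mem n a) (h.mono n.zero_le (h.apply_mem 0 a)))
    ((h.norm_apply_sub_apply_zero_le n a).trans (ha 0))
  linarith [ha n]

theorem isQQCMS_towerLip [Nontrivial A] {x : ℕ → ℝ} (hx : ∀ n, 0 < x n)
    (hx0 : Tendsto x atTop (𝓝 0)) : IsQQCMS 2 0 (towerLip E x) where
  nontrivial := inferInstance
  map_add_le := towerLip_add_le hx
  map_smul := towerLip_smul E x
  dense_domain := h.dense_towerLip_lt_top x
  eq_zero_iff := h.towerLip_eq_zero_iff hx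
  jordan_le a b _ _ := by
    refine (towerLip_le_of_forall (c := jordanMul a b) (a := a) (b := b) hx fun n => ?_).trans_eq
      (by simp)
    have h1 := h.norm_jordan_sub_le n a b (1 / 2) (by simp) 1 (by simp)
    rwa [one_smul] at h1
  lie_le a b _ _ := by
    refine (towerLip_le_of_forall (c := lieMul a b) (a := a) (b := b) hx fun n => ?_).trans_eq
      (by simp)
    have h1 := h.norm_jordan_sub_le n a b (1 / (2 * Complex.I)) (by simp) (-1) (by simp)
    rwa [neg_one_smul, ← sub_eq_add_neg] at h1
  metrizes := exists_metricSpace_of_eventually_mkDist_lt (towerLip_smul E x)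
    (h.dense_towerLip_lt_top x) (h.mkDist_towerLip_ne_top hx)
    fun φ _ hε => h.eventually_mkDist_towerLip_lt hx hx0 φ hε
  lowerSemicontinuous := lowerSemicontinuous_towerLip E x

end IsExpectationTower

end Metrization

/-! ### The identity bridge and comparison of unit balls -/

section Propinquity

variable {A : Type u} [CStarAlgebra A]

theorem mem_levelSet_one (φ : stateSpace A) : φ ∈ levelSet (1 : A) := by
  simp [levelSet]

/-- The bridge from `A` to itself given by the identity maps and the pivot `1`. -/
def idBridge (φ : stateSpace A) : Bridge A A where
  alg := A
  left := StarAlgHom.id ℂ A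
  right := StarAlgHom.id ℂ A
  left_injective := Function.injective_id
  right_injective := Function.injective_id
  pivot := 1
  levelSet_nonempty := ⟨φ, mem_levelSet_one φ⟩

/-- Every state belongs to the level set of `1`. -/
theorem idBridge_height (φ : stateSpace A) (L₁ L₂ : selfAdjoint A → ℝ≥0∞) :
    (idBridge φ).height L₁ L₂ = 0 := by
  have h1 : dualImage (StarAlgHom.id ℂ A) (levelSet (1 : A)) = Set.univ :=
    Set.eq_univ_of_forall fun ψ => ⟨ψ, mem_levelSet_one ψ, fun _ => rfl⟩
  have h2 : ∀ L : selfAdjoint A → ℝ≥0∞,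
      hausDist (mkDist L) Set.univ (dualImage (StarAlgHom.id ℂ A) (levelSet (1 : A))) = 0 := by
    intro L
    rw [h1, hausDist, ← nonpos_iff_eq_zero, max_le_iff]
    exact ⟨iSup₂_le fun ψ hψ => (iInf₂_le ψ hψ).trans_eq (mkDist_self L ψ),
      iSup₂_le fun ψ hψ => (iInf₂_le ψ hψ).trans_eq (mkDist_self L ψ)⟩
  exact (congrArg₂ max (h2 L₁) (h2 L₂)).trans (max_self 0)

theorem idBridge_length_le (φ : stateSpace A) {L₁ L₂ : selfAdjoint A → ℝ≥0∞} {ε : ℝ}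
    (h₁ : ∀ a, L₁ a ≤ 1 → ∃ b, L₂ b ≤ 1 ∧ ‖(a : A) - b‖ ≤ ε)
    (h₂ : ∀ b, L₂ b ≤ 1 → ∃ a, L₁ a ≤ 1 ∧ ‖(b : A) - a‖ ≤ ε) :
    (idBridge φ).length L₁ L₂ ≤ ENNReal.ofReal ε := by
  have hs : ∀ a b : A, (idBridge φ).seminorm a b = ENNReal.ofReal ‖a - b‖ := by
    intro a b
    rw [ofReal_norm]
    change ‖a * 1 - 1 * b‖ₑ = _
    rw [mul_one, one_mul]
  rw [Bridge.length, idBridge_height, zero_max, Bridge.reach, hausDist, max_le_iff]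
  constructor
  · refine iSup₂_le fun a ha => ?_
    obtain ⟨b, hb, hab⟩ := h₁ a ha
    exact (iInf₂_le b hb).trans ((hs a b).trans_le (ENNReal.ofReal_le_ofReal hab))
  · refine iSup₂_le fun b hb => ?_
    obtain ⟨a, ha, hab⟩ := h₂ b hb
    refine (iInf₂_le a ha).trans ((hs a b).trans_le (ENNReal.ofReal_le_ofReal ?_))
    rwa [norm_sub_rev]

namespace IsExpectationTower

variable {B : ℕ → StarSubalgebra ℂ A} {E : ℕ → A →L[ℂ] A} (h : IsExpectationTower B E)
include h

/-- An element of the unit ball for the sequence `x` is approximated by contracting its image in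
the `N`-th subalgebra towards the scalars. -/
theorem exists_norm_sub_le {x y : ℕ → ℝ} (hx : ∀ n, 0 < x n) (hy : ∀ n, 0 < y n) {N : ℕ} {r : ℝ}
    (hr : 1 ≤ r) (hxy : ∀ n < N, x n ≤ r * y n) {a : selfAdjoint A} (ha : towerLip E x a ≤ 1) :
    ∃ b, towerLip E y b ≤ 1 ∧ ‖(a : A) - b‖ ≤ x N + (r - 1) * x 0 := by
  have hr0 : 0 < r := zero_lt_one.trans_le hr
  rw [towerLip_le_one_iff hx] at ha
  have hsa : ∀ n, IsSelfAdjoint (E n a) := fun n => by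
    rw [IsSelfAdjoint, ← h.map_star, a.2.star_eq]
  -- The scalar part is kept and only the rest is shrunk. Dividing by `r` turns the bound `x n` into
  -- `y n`, and the cost is controlled by `‖a - E 0 a‖ ≤ x 0`.
  let b : A := E 0 a + ((r⁻¹ : ℝ) : ℂ) • (E N a - E 0 a)
  have hb : IsSelfAdjoint b := by
    refine (hsa 0).add (IsSelfAdjoint.smul ?_ ((hsa N).sub (hsa 0)))
    exact Complex.conj_ofReal _
  have hbN : b ∈ B N := by
    have h0 := h.mono N.zero_le (h.apply_mem 0 a)
    exact add_mem h0 ((B N).smul_mem (sub_mem (h.apply_mem N a) h0) _)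
  refine ⟨⟨b, hb⟩, (towerLip_le_one_iff hy).mpr fun n => ?_, ?_⟩
  · change ‖b - E n b‖ ≤ y n
    by_cases hn : n < N
    · have e : b - E n b = ((r⁻¹ : ℝ) : ℂ) • E N (a - E n a) := by
        simp only [b, map_add, map_smul, map_sub]
        rw [h.apply_apply n N hn.le, h.apply_of_mem n _ (h.mono n.zero_le (h.apply_mem 0 a)),
          h.apply_of_mem N _ (h.mono hn.le (h.apply_mem n a))]
        module
      rw [e, norm_smul, Complex.norm_real, Real.norm_of_nonneg (inv_nonneg.mpr hr0.le),
        inv_mul_le_iff₀ hr0]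
      exact ((h.norm_apply_le _ _).trans (ha n)).trans (hxy n hn)
    · rw [h.apply_of_mem n b (h.mono (not_lt.mp hn) hbN), sub_self, norm_zero]
      exact (hy n).le
  · have e : (a : A) - b = (a - E N a) + ((1 - r⁻¹ : ℝ) : ℂ) • (E N a - E 0 a) := by
      simp only [b, Complex.ofReal_sub, Complex.ofReal_one]
      module
    have hr1 : 0 ≤ 1 - r⁻¹ := sub_nonneg.mpr (inv_le_one_of_one_le₀ hr)
    -- The difference of the two sides is `(r - 1)² / r`.
    have hr2 : 1 - r⁻¹ ≤ r - 1 := by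
      have := mul_inv_cancel₀ hr0.ne'
      nlinarith
    change ‖(a : A) - b‖ ≤ _
    rw [e]
    refine (norm_add_le _ _).trans (add_le_add (ha N) ?_)
    rw [norm_smul, Complex.norm_real, Real.norm_of_nonneg hr1]
    exact mul_le_mul hr2 ((h.norm_apply_sub_apply_zero_le N a).trans (ha 0)) (norm_nonneg _)
      (hr1.trans hr2)

theorem eventually_idBridge_length_le (φ : stateSpace A) {β : ℕ → ℝ} (hβ : ∀ n, 0 < β n)
    (hβ0 : Tendsto β atTop (𝓝 0)) {x : ℕ → ℕ → ℝ} {y : ℕ → ℝ} (hx : ∀ k, x k ∈ nullBelow β)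
    (hy : y ∈ nullBelow β) (hxy : ∀ n, Tendsto (fun k => x k n) atTop (𝓝 (y n))) {ε : ℝ}
    (hε : 0 < ε) :
    ∀ᶠ k in atTop, (idBridge φ).length (towerLip E (x k)) (towerLip E y) ≤ ENNReal.ofReal ε := by
  obtain ⟨N, hN⟩ := (hβ0.eventually_lt_const (half_pos hε)).exists
  -- With `r = 1 + ε / (2 * β 0)`, shrinking costs at most `ε / 2`; the tail beyond `N` costs the
  -- other half.
  have hs : 0 < ε / (2 * β 0) := div_pos hε (mul_pos two_pos (hβ 0))
  have hsβ : ε / (2 * β 0) * β 0 = ε / 2 := by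
    have := (hβ 0).ne'
    field_simp
  have hbound : ∀ z ∈ nullBelow β, z N + (1 + ε / (2 * β 0) - 1) * z 0 ≤ ε := by
    intro z hz
    have h1 := mul_le_mul_of_nonneg_left (hz.2 0).2 hs.le
    rw [add_sub_cancel_left]
    linarith [(hz.2 N).2]
  have h1 : ∀ᶠ k in atTop, ∀ n ∈ Finset.range N,
      x k n ≤ (1 + ε / (2 * β 0)) * y n ∧ y n ≤ (1 + ε / (2 * β 0)) * x k n := by
    -- Positivity of the limit `y n` makes both comparisons hold eventually; finiteness of the index
    -- set makes them simultaneous.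
    refine (Filter.eventually_all_finset _).mpr fun n _ => ?_
    have hlt : y n < (1 + ε / (2 * β 0)) * y n := by
      linarith [mul_pos hs (hy.2 n).1]
    exact ((hxy n).eventually_le_const hlt).and
      (((hxy n).const_mul (1 + ε / (2 * β 0))).eventually_const_le hlt)
  filter_upwards [h1] with k hk
  have hr : 1 ≤ 1 + ε / (2 * β 0) := by linarith
  refine idBridge_length_le φ (fun a ha => ?_) fun b hb => ?_
  · obtain ⟨b, hb, hab⟩ := h.exists_norm_sub_le (fun n => ((hx k).2 n).1) (fun n => (hy.2 n).1) hr
      (fun n hn => (hk n (Finset.mem_range.mpr hn)).1) ha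
    exact ⟨b, hb, hab.trans (hbound _ (hx k))⟩
  · obtain ⟨a, ha, hab⟩ := h.exists_norm_sub_le (fun n => (hy.2 n).1) (fun n => ((hx k).2 n).1) hr
      (fun n hn => (hk n (Finset.mem_range.mpr hn)).2) hb
    exact ⟨a, ha, hab.trans (hbound _ hy)⟩

end IsExpectationTower

end Propinquity

/-! ### Application to the inductive limit -/

section InductiveLimit

variable {A : Type u} [CStarAlgebra A] {μ : WeakDual ℂ A}

/-- Identities come from orthogonality; in particular `E m ∘ E n = E m` because a test element of `B
m` also lies in `B n`. -/
theorem isExpectationTower_condExp (hμ : μ ∈ stateSpace A) (hμt : IsTracial μ)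
    (hμf : IsFaithful μ) {B : ℕ → StarSubalgebra ℂ A} [∀ n, FiniteDimensional ℂ (B n)]
    (hmono : Monotone B) (hdense : Dense (⋃ n, (B n : Set A)))
    (h0 : ∀ b ∈ B 0, ∃ z : ℂ, b = z • (1 : A)) :
    IsExpectationTower B fun n => condExp μ (B n) := by
  have hE : ∀ n, IsPreservingCondExp μ (B n) (condExp μ (B n)) := fun n =>
    isPreservingCondExp_condExp hμ hμt hμf
  refine ⟨fun n => inferInstance, hmono, hdense, h0, fun n => (hE n).1.apply_mem, ?_, ?_, ?_, ?_, ?_⟩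
  · exact fun n b hb => eq_of_forall_state_mul_eq hμf ((hE n).1.apply_mem b) hb fun c hc =>
      (hE n).state_mul_apply hc b
  · refine fun m n hmn a => eq_of_forall_state_mul_eq hμf ((hE m).1.apply_mem _)
      ((hE m).1.apply_mem _) fun c hc => ?_
    rw [(hE m).state_mul_apply hc, (hE m).state_mul_apply hc, (hE n).state_mul_apply (hmono hmn hc)]
  · intro n a
    have h := (condExp μ (B n)).le_opNorm a
    rwa [(hE n).1.norm_eq_one, one_mul] at h
  · intro n a
    refine eq_of_forall_state_mul_eq hμf ((hE n).1.apply_mem _) (star_mem ((hE n).1.apply_mem a))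
      fun b hb => ?_
    have key : ∀ c, μ (b * star c) = star (μ (star b * c)) := fun c => by
      rw [hμt (star b), ← state_map_star hμ, star_mul, star_star]
    rw [(hE n).state_mul_apply hb, key, key, (hE n).state_mul_apply (star_mem hb)]
  · intro n b hb a
    have h := (hE n).1.bimodule 1 (B n).one_mem b hb a
    rwa [one_mul, one_mul] at h

theorem IsInductiveLimit.monotone_range {𝔄 : ℕ → Type v} [∀ n, CStarAlgebra (𝔄 n)]
    {α : ∀ n, 𝔄 n →⋆ₐ[ℂ] 𝔄 (n + 1)} {ι : ∀ n, 𝔄 n →⋆ₐ[ℂ] A} (hι : IsInductiveLimit α ι) :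
    Monotone fun n => (ι n).range := by
  refine monotone_nat_of_le_succ fun n => ?_
  rintro _ ⟨a, rfl⟩
  exact ⟨α n a, hι.comp_eq n a⟩

theorem exists_eq_smul_one_of_mem_range {C : Type v} [CStarAlgebra C]
    (e : C ≃⋆ₐ[ℂ] ℂ) (f : C →⋆ₐ[ℂ] A) : ∀ b ∈ f.range, ∃ z : ℂ, b = z • (1 : A) := by
  rintro _ ⟨a, rfl⟩
  refine ⟨e a, ?_⟩
  have h : a = e a • (1 : C) := EquivLike.injective e (by
    rw [map_smul, map_one, smul_eq_mul, mul_one])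
  change f a = _
  conv_lhs => rw [h, map_smul, map_one]

end InductiveLimit

end QuantumMetric

end

open QuantumMetric in
theorem mainTheorem6 {A : Type*} [CStarAlgebra A]
    {𝔄 : ℕ → Type*} [∀ n, CStarAlgebra (𝔄 n)] [∀ n, FiniteDimensional ℂ (𝔄 n)]
    (h𝔄 : Nonempty (𝔄 0 ≃⋆ₐ[ℂ] ℂ))
    (α : ∀ n, 𝔄 n →⋆ₐ[ℂ] 𝔄 (n + 1)) (hα : ∀ n, Function.Injective (α n))
    (ι : ∀ n, 𝔄 n →⋆ₐ[ℂ] A) (hι : IsInductiveLimit α ι)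
    (μ : WeakDual ℂ A) (hμ : μ ∈ stateSpace A) (hμt : IsTracial μ) (hμf : IsFaithful μ)
    (β : ℕ → ℝ) (hβ : ∀ n, 0 < β n) (hβ0 : Tendsto β atTop (𝓝 0))
    (x : ℕ → ℕ → ℝ) (y : ℕ → ℝ) (hx : ∀ k, x k ∈ nullBelow β) (hy : y ∈ nullBelow β)
    (hxy : ∀ n, Tendsto (fun k => x k n) atTop (𝓝 (y n))) :
    (∀ n, ∃! E, IsPreservingCondExp μ (ι n).range E) ∧
    ∃ (hX : ∀ k, IsQQCMS 2 0 (lipNorm ι μ (x k))) (hY : IsQQCMS 2 0 (lipNorm ι μ y)),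
      Tendsto
        (fun k => qPropinquity (C := 2) (D := 0)
          ⟨A, lipNorm ι μ (x k), hX k⟩ ⟨A, lipNorm ι μ y, hY⟩)
        atTop (𝓝 0) := by
  have hfin : ∀ n, FiniteDimensional ℂ (ι n).range := fun n =>
    (ι n).toAlgHom.toLinearMap.finiteDimensional_range
  have hnt : Nontrivial A := ⟨1, 0, fun h => by simpa [h] using hμ.1⟩
  have hdense : Dense (⋃ n, ((ι n).range : Set A)) := hι.dense
  have htower := isExpectationTower_condExp hμ hμt hμf hι.monotone_range hdense
    (exists_eq_smul_one_of_mem_range h𝔄.some (ι 0))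
  -- `lipNorm` unfolds definitionally to `towerLip` of this tower.
  have hX : ∀ k, IsQQCMS 2 0 (lipNorm ι μ (x k)) := fun k =>
    htower.isQQCMS_towerLip (fun n => ((hx k).2 n).1) (hx k).1
  have hY : IsQQCMS 2 0 (lipNorm ι μ y) := htower.isQQCMS_towerLip (fun n => (hy.2 n).1) hy.1
  refine ⟨fun n => existsUnique_isPreservingCondExp hμ hμt hμf, hX, hY, ?_⟩
  refine ENNReal.tendsto_nhds_zero.mpr fun ε hε => ?_
  obtain ⟨δ, hδ0, hδε⟩ := ENNReal.lt_iff_exists_nnreal_btwn.mp hε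
  filter_upwards [htower.eventually_idBridge_length_le ⟨μ, hμ⟩ hβ hβ0 hx hy hxy
    (NNReal.coe_pos.mpr (ENNReal.coe_pos.mp hδ0))] with k hk
  rw [ENNReal.ofReal_coe_nnreal] at hk
  -- A single bridge already bounds the propinquity; `μ` itself witnesses that its level set is
  -- nonempty.
  exact (qPropinquity_isGreatest.1.2.2 ⟨A, _, hX k⟩ ⟨A, _, hY⟩ (idBridge ⟨μ, hμ⟩)).trans
    (hk.trans hδε.le)
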